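/- Theorem. There is an absolute constant $D$ with the following property. Let $n\ge 2$ and $\ell\ge 2$ be integers, let $A=\{v_1,\dots,v_n\}$ be a set of $n$ distinct integers, and let $Y=Y_1+\dots+Y_\ell$, where $Y_1,\dots,Y_\ell$ are independent random variables, each uniformly distributed on $A$. Then $$\max_{x\in\mathbb{Z}}\mathbb{P}[Y=x]\le\frac{D}{n\sqrt{\ell-1}}.$$ In particular, for every $\epsilon>0$ there is an integer $L$, depending only on $\epsilon$, such that for every $\ell\ge L$, every $n\ge 2$ and every set $A$ of $n$ distinct integers, the sum $Y$ of $\ell$ independent random variables uniformly distributed on $A$ satisfies $$\max_{x\in\mathbb{Z}}\mathbb{P}[Y=x]\le\frac{\epsilon}{n}.$$ -/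

import Mathlib

open MeasureTheory ProbabilityTheory

universe u

/-- `Y 0, …, Y (ℓ - 1)` are independent random variables on the probability space `(Ω, μ)`,
each of them uniformly distributed on the finite set of integers `A`. -/
def IsIIDUniformOn {Ω : Type u} [MeasurableSpace Ω] (μ : Measure Ω) {ℓ : ℕ}
    (Y : Fin ℓ → Ω → ℤ) (A : Finset ℤ) : Prop :=
  iIndepFun Y μ ∧ ∀ i, HasLaw (Y i) (uniformOn (A : Set ℤ)) μ

/-- `m` is the maximum over all integers `x` of the probability `P[Z = x]`
(in particular this maximum is attained). -/
def IsMaxPointProb {Ω : Type u} [MeasurableSpace Ω] (μ : Measure Ω) (Z : Ω → ℤ) (m : ℝ) : Prop :=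
  IsGreatest (Set.range fun x : ℤ => μ.real {ω | Z ω = x}) m

section Fourier

open Finset
open scoped Pointwise

variable {p : ℕ} [Fact p.Prime] (B : Finset (ZMod p))

/-- The unnormalised exponential sum of `B` at the frequency `t`. -/
noncomputable def expSum (t : ZMod p) : ℂ := ∑ b ∈ B, ZMod.stdAddChar (b * t)

/-- The defect `1 - |φ(t)|²`, where `φ` is the characteristic function of the uniform
distribution on `B`. -/
noncomputable def fourierDefect (t : ZMod p) : ℝ := 1 - (‖expSum B t‖ / #B) ^ 2

lemma fourierDefect_le_one (t : ZMod p) : fourierDefect B t ≤ 1 := by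
  unfold fourierDefect
  nlinarith [sq_nonneg (‖expSum B t‖ / #B)]

lemma sum_norm_sub_sq (t : ZMod p) (hB : B.Nonempty) :
    ∑ a ∈ B, ∑ b ∈ B, ‖(ZMod.stdAddChar (a * t) : ℂ) - ZMod.stdAddChar (b * t)‖ ^ 2
      = 2 * (#B : ℝ) ^ 2 * fourierDefect B t := by
  have hn : (#B : ℝ) ≠ 0 := by exact_mod_cast hB.card_pos.ne'
  have key : ∑ a ∈ B, ∑ b ∈ B,
      inner ℝ (ZMod.stdAddChar (a * t) : ℂ) (ZMod.stdAddChar (b * t)) = ‖expSum B t‖ ^ 2 := by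
    rw [← real_inner_self_eq_norm_sq, expSum, sum_inner]
    simp_rw [inner_sum]
  simp_rw [norm_sub_sq_real, AddChar.norm_apply, sum_add_distrib, sum_sub_distrib, ← mul_sum, key]
  simp only [one_pow, sum_const, nsmul_eq_mul, mul_one, fourierDefect]
  field_simp
  ring

lemma fourierDefect_nonneg (hB : B.Nonempty) (t : ZMod p) : 0 ≤ fourierDefect B t := by
  have hn : (0 : ℝ) < #B := by exact_mod_cast hB.card_pos
  have h := sum_norm_sub_sq B t hB
  have h0 : 0 ≤ 2 * (#B : ℝ) ^ 2 * fourierDefect B t := by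
    rw [← h]; positivity
  exact nonneg_of_mul_nonneg_right h0 (by positivity)

lemma fourierDefect_zero (hB : B.Nonempty) : fourierDefect B 0 = 0 := by
  have hn : (#B : ℝ) ≠ 0 := by exact_mod_cast hB.card_pos.ne'
  simp [fourierDefect, expSum, hn]

lemma fourierDefect_add_le (hB : B.Nonempty) (s t : ZMod p) :
    fourierDefect B (s + t) ≤ 2 * (fourierDefect B s + fourierDefect B t) := by
  have hn : (0 : ℝ) < #B := by exact_mod_cast hB.card_pos
  have key : 2 * (#B : ℝ) ^ 2 * fourierDefect B (s + t) ≤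
      2 * (2 * (#B : ℝ) ^ 2 * fourierDefect B s + 2 * (#B : ℝ) ^ 2 * fourierDefect B t) := by
    simp_rw [← sum_norm_sub_sq B _ hB]
    simp_rw [← sum_add_distrib, mul_sum]
    refine sum_le_sum fun a _ => sum_le_sum fun b _ => ?_
    simp_rw [mul_add, AddChar.map_add_eq_mul]
    set x : ℂ := ZMod.stdAddChar (a * s)
    set y : ℂ := ZMod.stdAddChar (a * t)
    set z : ℂ := ZMod.stdAddChar (b * s)
    set w : ℂ := ZMod.stdAddChar (b * t)
    have hy : ‖y‖ = 1 := AddChar.norm_apply _ _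
    have hz : ‖z‖ = 1 := AddChar.norm_apply _ _
    have h : ‖x * y - z * w‖ ≤ ‖x - z‖ + ‖y - w‖ := by
      calc ‖x * y - z * w‖ = ‖(x - z) * y + z * (y - w)‖ := by ring_nf
        _ ≤ ‖(x - z) * y‖ + ‖z * (y - w)‖ := norm_add_le _ _
        _ = _ := by rw [norm_mul, norm_mul, hy, hz, mul_one, one_mul]
    nlinarith [sq_nonneg (‖x - z‖ - ‖y - w‖), norm_nonneg (x * y - z * w)]
  have hp : (0 : ℝ) < 2 * (#B : ℝ) ^ 2 := by positivity
  refine le_of_mul_le_mul_left ?_ hp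
  linarith

lemma sum_norm_expSum_sq : ∑ t, ‖expSum B t‖ ^ 2 = (p : ℝ) * #B := by
  have h : ∀ t : ZMod p, ((‖expSum B t‖ ^ 2 : ℝ) : ℂ)
      = ∑ a ∈ B, ∑ b ∈ B, (ZMod.stdAddChar (t * (a - b)) : ℂ) := by
    intro t
    push_cast
    rw [← Complex.mul_conj', expSum, map_sum, sum_mul_sum]
    refine sum_congr rfl fun a _ => sum_congr rfl fun b _ => ?_
    rw [← AddChar.map_neg_eq_conj, ← AddChar.map_add_eq_mul]
    congr 1; ring
  have h2 : ((∑ t, ‖expSum B t‖ ^ 2 : ℝ) : ℂ) = (p : ℂ) * #B := by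
    rw [Complex.ofReal_sum, sum_congr rfl fun t _ => h t, sum_comm]
    have h3 : ∀ a ∈ B, ∑ t, ∑ b ∈ B, (ZMod.stdAddChar (t * (a - b)) : ℂ) = p := by
      intro a ha
      rw [sum_comm]
      simp_rw [AddChar.sum_mulShift _ (ZMod.isPrimitive_stdAddChar p), sub_eq_zero]
      simp [ha, ZMod.card]
    rw [sum_congr rfl h3]
    simp [mul_comm]
  exact_mod_cast h2

lemma sum_one_sub_fourierDefect (hB : B.Nonempty) :
    ∑ t, (1 - fourierDefect B t) = (p : ℝ) / #B := by
  have hn : (#B : ℝ) ≠ 0 := by exact_mod_cast hB.card_pos.ne'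
  simp_rw [fourierDefect, sub_sub_cancel, div_pow, ← sum_div, sum_norm_expSum_sq]
  field_simp

/-- The frequencies whose defect is at most `1 / 4 ^ (i + 1)`. -/
noncomputable def smallDefect (i : ℕ) : Finset (ZMod p) :=
  {t | fourierDefect B t ≤ 1 / (4 * 4 ^ i)}

lemma mem_smallDefect {i : ℕ} {t : ZMod p} :
    t ∈ smallDefect B i ↔ fourierDefect B t ≤ 1 / (4 * 4 ^ i) := by
  simp [smallDefect]

lemma smallDefect_anti {i j : ℕ} (h : i ≤ j) : smallDefect B j ⊆ smallDefect B i := by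
  intro t
  simp only [mem_smallDefect]
  intro ht
  refine ht.trans ?_
  gcongr
  norm_num

lemma zero_mem_smallDefect (hB : B.Nonempty) (i : ℕ) : 0 ∈ smallDefect B i := by
  rw [mem_smallDefect, fourierDefect_zero B hB]; positivity

lemma smallDefect_add_subset (hB : B.Nonempty) (i : ℕ) :
    smallDefect B (i + 1) + smallDefect B (i + 1) ⊆ smallDefect B i := by
  intro x hx
  obtain ⟨s, hs, t, ht, rfl⟩ := mem_add.1 hx
  rw [mem_smallDefect] at *
  have h := fourierDefect_add_le B hB s t
  have e : (1 : ℝ) / (4 * 4 ^ i) = 4 * (1 / (4 * 4 ^ (i + 1))) := by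
    rw [pow_succ]; field_simp
  linarith

lemma card_smallDefect_zero_le (hB : B.Nonempty) :
    (#(smallDefect B 0) : ℝ) ≤ 4 / 3 * (p / #B) := by
  have h : ∑ t ∈ smallDefect B 0, (3 / 4 : ℝ) ≤ p / #B := by
    rw [← sum_one_sub_fourierDefect B hB]
    refine (sum_le_sum fun t ht => ?_).trans
      (sum_le_univ_sum_of_nonneg fun t => sub_nonneg.2 (fourierDefect_le_one B t))
    rw [mem_smallDefect] at ht
    norm_num at ht
    linarith
  rw [sum_const, nsmul_eq_mul] at h
  linarith

lemma card_smallDefect_le (hB : 2 ≤ #B) (i : ℕ) :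
    (#(smallDefect B i) : ℝ) ≤ 1 + 4 / 3 * (p / #B) / 2 ^ i := by
  have hne : B.Nonempty := card_pos.1 (by omega)
  have hp : (0 : ℝ) < p := by exact_mod_cast (Fact.out : p.Prime).pos
  have h2 : (2 : ℝ) ≤ #B := by exact_mod_cast hB
  have h0 := card_smallDefect_zero_le B hne
  induction i with
  | zero => simp only [pow_zero, div_one]; linarith
  | succ i ih =>
    have hcd := (ZMod.cauchy_davenport (Fact.out : p.Prime) ⟨0, zero_mem_smallDefect B hne (i + 1)⟩
      ⟨0, zero_mem_smallDefect B hne (i + 1)⟩).trans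
      (card_le_card (smallDefect_add_subset B hne i))
    have hlt : #(smallDefect B i) < p := by
      have h1 : (#(smallDefect B i) : ℝ) ≤ #(smallDefect B 0) := by
        exact_mod_cast card_le_card (smallDefect_anti B (Nat.zero_le i))
      have h3 : (p : ℝ) / #B ≤ p / 2 := by gcongr
      have : (#(smallDefect B i) : ℝ) < p := by linarith
      exact_mod_cast this
    have h4 : 2 * #(smallDefect B (i + 1)) ≤ #(smallDefect B i) + 1 := by omega
    have h5 : (2 * #(smallDefect B (i + 1)) : ℝ) ≤ #(smallDefect B i) + 1 := by exact_mod_cast h4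
    rw [pow_succ, ← div_div]
    linarith

lemma one_sub_pow_le {u : ℝ} (h0 : 0 ≤ u) (h1 : u ≤ 1) (m : ℕ) :
    (1 - u) ^ m ≤ 1 / (1 + m * u) := by
  have hb : 1 + (m : ℝ) * u ≤ (1 + u) ^ m := one_add_mul_le_pow (by linarith) m
  have hpos : (0 : ℝ) < 1 + m * u := by positivity
  rw [le_div_iff₀ hpos]
  calc (1 - u) ^ m * (1 + m * u) ≤ (1 - u) ^ m * (1 + u) ^ m :=
        mul_le_mul_of_nonneg_left hb (pow_nonneg (by linarith) m)
    _ = (1 - u ^ 2) ^ m := by rw [← mul_pow]; ring_nf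
    _ ≤ 1 := pow_le_one₀ (by nlinarith) (by nlinarith)

lemma sum_smallDefect_sdiff_le (hB : 2 ≤ #B) {m : ℕ} (hm : 1 ≤ m) (i : ℕ) :
    ∑ t ∈ smallDefect B 0 \ smallDefect B i, (1 - fourierDefect B t) ^ m
      ≤ 16 / m * (4 ^ i + 4 / 3 * (p / #B) * 2 ^ i) := by
  have hne : B.Nonempty := card_pos.1 (by omega)
  have hm' : (0 : ℝ) < m := by exact_mod_cast hm
  induction i with
  | zero => simp; positivity
  | succ i ih =>
    have hsplit : smallDefect B 0 \ smallDefect B (i + 1) ⊆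
        (smallDefect B 0 \ smallDefect B i) ∪ (smallDefect B i \ smallDefect B (i + 1)) := by
      intro t; simp only [mem_union, mem_sdiff]; tauto
    have hnn : ∀ t, 0 ≤ (1 - fourierDefect B t) ^ m := fun t =>
      pow_nonneg (sub_nonneg.2 (fourierDefect_le_one B t)) m
    have hshell : ∑ t ∈ smallDefect B i \ smallDefect B (i + 1), (1 - fourierDefect B t) ^ m
        ≤ 16 * 4 ^ i / m * (1 + 4 / 3 * (p / #B) / 2 ^ i) := by
      calc _ ≤ ∑ t ∈ smallDefect B i \ smallDefect B (i + 1), (16 * 4 ^ i / m : ℝ) := by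
            refine sum_le_sum fun t ht => ?_
            rw [mem_sdiff, mem_smallDefect, mem_smallDefect, not_le] at ht
            have hu := fourierDefect_nonneg B hne t
            refine (one_sub_pow_le hu (fourierDefect_le_one B t) m).trans ?_
            have h1 : (16 * 4 ^ i / m : ℝ) = 1 / (m * (1 / (4 * 4 ^ (i + 1)))) := by
              rw [pow_succ]; field_simp; norm_num
            rw [h1]
            apply one_div_le_one_div_of_le (by positivity)
            have := mul_le_mul_of_nonneg_left ht.2.le hm'.le
            linarith
        _ = 16 * 4 ^ i / m * #(smallDefect B i \ smallDefect B (i + 1)) := by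
            rw [sum_const, nsmul_eq_mul, mul_comm]
        _ ≤ _ := by
            gcongr
            refine le_trans ?_ (card_smallDefect_le B hB i)
            exact_mod_cast card_le_card sdiff_subset
    have hcalc : 16 * 4 ^ i / m * (1 + 4 / 3 * (p / #B) / 2 ^ i)
        = 16 / m * (4 ^ i + 4 / 3 * (p / #B) * 2 ^ i : ℝ) := by
      have : (4 : ℝ) ^ i = 2 ^ i * 2 ^ i := by rw [← mul_pow]; norm_num
      rw [this]; field_simp
    have hdisj : Disjoint (smallDefect B 0 \ smallDefect B i)
        (smallDefect B i \ smallDefect B (i + 1)) := by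
      rw [disjoint_left]; intro t; simp only [mem_sdiff]; tauto
    have hun := sum_le_sum_of_subset_of_nonneg hsplit fun t _ _ => hnn t
    rw [sum_union hdisj] at hun
    calc _ ≤ 16 / m * (4 ^ i + 4 / 3 * (p / #B) * 2 ^ i)
            + 16 / m * (4 ^ i + 4 / 3 * (p / #B) * 2 ^ i : ℝ) := by linarith
      _ = 16 / m * (2 * 4 ^ i + 4 / 3 * (p / #B) * 2 ^ (i + 1)) := by ring
      _ ≤ _ := by
          gcongr
          rw [pow_succ]
          have : (0 : ℝ) < 4 ^ i := by positivity
          linarith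

lemma sum_compl_smallDefect_le (hB : B.Nonempty) {m : ℕ} (hm : 1 ≤ m) :
    ∑ t ∈ (smallDefect B 0)ᶜ, (1 - fourierDefect B t) ^ m ≤ 4 / m * (p / #B) := by
  have hm' : (0 : ℝ) < m := by exact_mod_cast hm
  rw [← sum_one_sub_fourierDefect B hB, mul_sum]
  have hnn : ∀ t, 0 ≤ 1 - fourierDefect B t := fun t => sub_nonneg.2 (fourierDefect_le_one B t)
  refine (sum_le_sum fun t ht => ?_).trans
    (sum_le_univ_sum_of_nonneg fun t => mul_nonneg (by positivity) (hnn t))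
  rw [mem_compl, mem_smallDefect, not_le] at ht
  norm_num at ht
  obtain ⟨k, rfl⟩ : ∃ k, m = k + 1 := ⟨m - 1, by omega⟩
  rw [pow_succ]
  refine mul_le_mul_of_nonneg_right ?_ (hnn t)
  refine (one_sub_pow_le (fourierDefect_nonneg B hB t) (fourierDefect_le_one B t) k).trans ?_
  have hk : (k : ℝ) * (1 / 4) ≤ k * fourierDefect B t :=
    mul_le_mul_of_nonneg_left ht.le (Nat.cast_nonneg k)
  have hk0 : (0 : ℝ) ≤ k := Nat.cast_nonneg k
  rw [div_le_div_iff₀ (by linarith) hm']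
  push_cast
  linarith

lemma sum_one_sub_fourierDefect_pow_le (hB : 2 ≤ #B) {m : ℕ} (hm : 1 ≤ m) (hp : #B * m ≤ p) :
    ∑ t, (1 - fourierDefect B t) ^ m ≤ 46 * (p / #B) / √m := by
  have hne : B.Nonempty := card_pos.1 (by omega)
  have hn : (0 : ℝ) < #B := by exact_mod_cast hne.card_pos
  have hm' : (1 : ℝ) ≤ m := by exact_mod_cast hm
  have hm0 : (0 : ℝ) < m := by linarith
  have hr0 : 0 < √(m : ℝ) := Real.sqrt_pos.2 hm0
  have hr1 : 1 ≤ √(m : ℝ) := Real.one_le_sqrt.2 hm'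
  have hrr : √(m : ℝ) * √(m : ℝ) = m := Real.mul_self_sqrt hm0.le
  set r := √(m : ℝ) with hr
  set q : ℝ := p / #B with hq
  have hqm : (m : ℝ) ≤ q := by
    rw [hq, le_div_iff₀ hn, mul_comm]; exact_mod_cast hp
  set K := Nat.log 4 m
  have h4K : (4 : ℝ) ^ K ≤ m := by exact_mod_cast Nat.pow_log_le_self 4 (by omega : m ≠ 0)
  have hK4 : (m : ℝ) < 4 ^ (K + 1) := by
    exact_mod_cast Nat.lt_pow_succ_log_self (by norm_num : 1 < 4) m
  have e4 : (4 : ℝ) ^ K = 2 ^ K * 2 ^ K := by rw [← mul_pow]; norm_num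
  have h2 : (0 : ℝ) < 2 ^ K := by positivity
  have h2K : (2 : ℝ) ^ K ≤ r := by nlinarith
  have hK2 : r ≤ 2 * 2 ^ K := by
    rw [pow_succ] at hK4; nlinarith
  have hnn : ∀ t, 0 ≤ (1 - fourierDefect B t) ^ m := fun t =>
    pow_nonneg (sub_nonneg.2 (fourierDefect_le_one B t)) m
  have hsmall : ∑ t ∈ smallDefect B K, (1 - fourierDefect B t) ^ m ≤ 1 + 4 / 3 * q / 2 ^ K := by
    refine le_trans ?_ (card_smallDefect_le B hB K)
    refine (sum_le_card_nsmul _ _ 1 fun t _ => ?_).trans (by simp)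
    exact pow_le_one₀ (sub_nonneg.2 (fourierDefect_le_one B t))
      (by linarith [fourierDefect_nonneg B hne t])
  have hmid := sum_smallDefect_sdiff_le B hB hm K
  have hfar := sum_compl_smallDefect_le B hne hm
  have hsum : ∑ t, (1 - fourierDefect B t) ^ m =
      ∑ t ∈ smallDefect B 0 \ smallDefect B K, (1 - fourierDefect B t) ^ m
        + ∑ t ∈ smallDefect B K, (1 - fourierDefect B t) ^ m
        + ∑ t ∈ (smallDefect B 0)ᶜ, (1 - fourierDefect B t) ^ m := by
    rw [sum_sdiff (smallDefect_anti B (Nat.zero_le K)), sum_add_sum_compl]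
  have hq0 : 0 < q := hm0.trans_le hqm
  have b1 : 16 / m * (4 ^ K + 4 / 3 * q * 2 ^ K) ≤ 16 + 64 / 3 * (q / r) := by
    calc 16 / m * (4 ^ K + 4 / 3 * q * 2 ^ K) ≤ 16 / m * (m + 4 / 3 * q * r) := by gcongr
      _ = 16 + 64 / 3 * (q / r) := by
          rw [← hrr]; field_simp; ring
  have b2 : 4 / 3 * q / 2 ^ K ≤ 8 / 3 * (q / r) := by
    have h3 : q * r ≤ q * (2 * 2 ^ K) := mul_le_mul_of_nonneg_left hK2 hq0.le
    have h4 : q / 2 ^ K ≤ 2 * q / r := by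
      rw [div_le_div_iff₀ h2 hr0]
      linarith
    linarith [mul_div_assoc (4 / 3) q (2 ^ K), mul_div_assoc 2 q r]
  have b3 : 4 / m * q ≤ 4 * (q / r) := by
    rw [← hrr, div_mul_eq_mul_div, mul_div_assoc]
    gcongr
    nlinarith
  have b4 : 1 ≤ q / r := by
    rw [le_div_iff₀ hr0]; nlinarith
  rw [hsum, mul_div_assoc]
  linarith

lemma sum_norm_expSum_div_pow_le (hB : 2 ≤ #B) {ℓ : ℕ} (hℓ : 2 ≤ ℓ) (hp : #B * ℓ ≤ p) :
    ∑ t, (‖expSum B t‖ / #B) ^ ℓ ≤ 92 * (p / #B) / √((ℓ : ℝ) - 1) := by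
  have hne : B.Nonempty := card_pos.1 (by omega)
  have hm : 1 ≤ ℓ / 2 := by omega
  have hp' : #B * (ℓ / 2) ≤ p := (Nat.mul_le_mul_left _ (Nat.div_le_self _ _)).trans hp
  calc ∑ t, (‖expSum B t‖ / #B) ^ ℓ ≤ ∑ t, (1 - fourierDefect B t) ^ (ℓ / 2) := by
        refine sum_le_sum fun t _ => ?_
        have hx : (‖expSum B t‖ / #B) ^ 2 ≤ 1 := by
          have := fourierDefect_nonneg B hne t
          unfold fourierDefect at this
          linarith
        have hx0 : 0 ≤ ‖expSum B t‖ / #B := by positivity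
        rw [fourierDefect, sub_sub_cancel, ← pow_mul]
        exact pow_le_pow_of_le_one hx0 ((sq_le_one_iff₀ hx0).1 hx) (by omega)
    _ ≤ 46 * (p / #B) / √((ℓ / 2 : ℕ) : ℝ) := sum_one_sub_fourierDefect_pow_le B hB hm hp'
    _ ≤ 92 * (p / #B) / √((ℓ : ℝ) - 1) := by
        have hm' : (0 : ℝ) < ((ℓ / 2 : ℕ) : ℝ) := by exact_mod_cast hm
        have hl : (2 : ℝ) ≤ ℓ := by exact_mod_cast hℓ
        have h1 : √((ℓ : ℝ) - 1) ≤ 2 * √((ℓ / 2 : ℕ) : ℝ) := by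
          rw [Real.sqrt_le_left (by positivity), mul_pow, Real.sq_sqrt hm'.le]
          have : ℓ ≤ 4 * (ℓ / 2) + 1 := by omega
          have : (ℓ : ℝ) ≤ 4 * ((ℓ / 2 : ℕ) : ℝ) + 1 := by exact_mod_cast this
          linarith
        have h2 : 0 < √((ℓ : ℝ) - 1) := Real.sqrt_pos.2 (by linarith)
        rw [div_le_div_iff₀ (Real.sqrt_pos.2 hm') h2]
        have : (0 : ℝ) ≤ p / #B := by positivity
        nlinarith [mul_le_mul_of_nonneg_left h1 this]

end Fourier

section Probability

variable {Ω : Type u} [MeasurableSpace Ω] {μ : Measure Ω}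

lemma integral_uniformOn_finset (A : Finset ℤ) (f : ℤ → ℂ) :
    ∫ x, f x ∂(uniformOn (A : Set ℤ)) = (∑ a ∈ A, f a) / A.card := by
  rw [uniformOn, ProbabilityTheory.cond, integral_smul_measure, setIntegral_finset]
  · simp [div_eq_inv_mul, Measure.real]
  · rw [← Set.biUnion_of_singleton (A : Set ℤ)]
    exact (integrableOn_finset_iUnion (s := A)).2 fun a _ =>
      integrableOn_singleton (by simp) (by simp)

lemma exists_isMaxPointProb [IsProbabilityMeasure μ] {Z : Ω → ℤ} (hZ : AEMeasurable Z μ) :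
    ∃ m, IsMaxPointProb μ Z m := by
  have hmap : ∀ x : ℤ, μ.real {ω | Z ω = x} = (μ.map Z {x}).toReal := fun x => by
    rw [Measure.map_apply_of_aemeasurable hZ (measurableSet_singleton x)]; rfl
  have : IsProbabilityMeasure (μ.map Z) := Measure.isProbabilityMeasure_map hZ
  have hsum : Summable fun x : ℤ => μ.real {ω | Z ω = x} := by
    simp_rw [hmap]
    refine ENNReal.summable_toReal ?_
    rw [← measure_iUnion (fun x y hxy => Set.disjoint_singleton.2 hxy) measurableSet_singleton]
    exact measure_ne_top _ _
  by_cases h0 : ∀ x : ℤ, μ.real {ω | Z ω = x} ≤ 0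
  · refine ⟨_, ⟨0, rfl⟩, ?_⟩
    rintro _ ⟨x, rfl⟩
    exact (h0 x).trans measureReal_nonneg
  · push Not at h0
    obtain ⟨x₀, hx₀⟩ := h0
    have hfin : {x : ℤ | μ.real {ω | Z ω = x₀} ≤ μ.real {ω | Z ω = x}}.Finite := by
      have := hsum.tendsto_cofinite_zero.eventually_lt_const hx₀
      rw [Filter.eventually_cofinite] at this
      simpa only [not_lt] using this
    obtain ⟨x₁, hx₁, hmax⟩ := Set.exists_max_image _ (fun x : ℤ => μ.real {ω | Z ω = x}) hfin
      ⟨x₀, le_refl (μ.real {ω | Z ω = x₀})⟩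
    refine ⟨_, ⟨x₁, rfl⟩, ?_⟩
    rintro _ ⟨x, rfl⟩
    rcases le_total (μ.real {ω | Z ω = x₀}) (μ.real {ω | Z ω = x}) with h | h
    · exact hmax x h
    · exact h.trans hx₁

/-- Fourier inversion on `ZMod p`, as an upper bound for point probabilities. -/
lemma pointProb_le_sum_norm_charFun [IsProbabilityMeasure μ] {Z : Ω → ℤ} (hZ : AEMeasurable Z μ)
    {p : ℕ} [Fact p.Prime] (x : ℤ) :
    (p : ℝ) * μ.real {ω | Z ω = x} ≤
      ∑ t : ZMod p, ‖∫ ω, (ZMod.stdAddChar ((Z ω : ZMod p) * t) : ℂ) ∂μ‖ := by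
  have hmeas : ∀ g : ℤ → ℂ, AEStronglyMeasurable (fun ω => g (Z ω)) μ := fun g =>
    ((measurable_of_countable g).comp_aemeasurable hZ).aestronglyMeasurable
  have hint : ∀ t : ZMod p, Integrable
      (fun ω => (ZMod.stdAddChar (((Z ω : ZMod p) - (x : ZMod p)) * t) : ℂ)) μ := fun t =>
    .of_bound (hmeas fun z => ZMod.stdAddChar (((z : ZMod p) - (x : ZMod p)) * t)) 1
      (.of_forall fun ω => (AddChar.norm_apply _ _).le)
  set s : Set ℤ := {z | (z : ZMod p) = x}
  have hs : NullMeasurableSet (Z ⁻¹' s) μ := hZ.nullMeasurable .of_discrete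
  have hle : μ.real {ω | Z ω = x} ≤ μ.real (Z ⁻¹' s) :=
    measureReal_mono fun ω (hω : Z ω = x) => by simp [s, hω]
  have hF : ∀ ω, ∑ t : ZMod p, (ZMod.stdAddChar (((Z ω : ZMod p) - (x : ZMod p)) * t) : ℂ)
      = (Z ⁻¹' s).indicator (fun _ => (p : ℂ)) ω := by
    intro ω
    simp_rw [mul_comm _ (_ : ZMod p)]
    rw [AddChar.sum_mulShift _ (ZMod.isPrimitive_stdAddChar p)]
    simp [Set.indicator_apply, s, sub_eq_zero, ZMod.card]
  have hI : ∑ t : ZMod p, ∫ ω, (ZMod.stdAddChar (((Z ω : ZMod p) - (x : ZMod p)) * t) : ℂ) ∂μ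
      = ((p * μ.real (Z ⁻¹' s) : ℝ) : ℂ) := by
    rw [← integral_finsetSum _ fun t _ => hint t]
    simp_rw [hF]
    rw [integral_indicator₀ hs]
    simp [mul_comm]
  have hnorm : ∀ t : ZMod p, ‖∫ ω, (ZMod.stdAddChar (((Z ω : ZMod p) - (x : ZMod p)) * t) : ℂ) ∂μ‖
      = ‖∫ ω, (ZMod.stdAddChar ((Z ω : ZMod p) * t) : ℂ) ∂μ‖ := by
    intro t
    simp_rw [sub_mul, sub_eq_add_neg, AddChar.map_add_eq_mul]
    rw [integral_mul_const, norm_mul, AddChar.norm_apply, mul_one]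
  calc (p : ℝ) * μ.real {ω | Z ω = x} ≤ p * μ.real (Z ⁻¹' s) := by gcongr
    _ = ‖((p * μ.real (Z ⁻¹' s) : ℝ) : ℂ)‖ := by
        rw [Complex.norm_real, Real.norm_of_nonneg (by positivity)]
    _ ≤ _ := by
        rw [← hI]
        refine (norm_sum_le _ _).trans_eq ?_
        exact Finset.sum_congr rfl fun t _ => hnorm t

lemma IsIIDUniformOn.integral_stdAddChar_sum {ℓ : ℕ} {Y : Fin ℓ → Ω → ℤ} {A : Finset ℤ}
    (h : IsIIDUniformOn μ Y A) {p : ℕ} [Fact p.Prime]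
    (hA : Set.InjOn (Int.cast : ℤ → ZMod p) A) (t : ZMod p) :
    ∫ ω, (ZMod.stdAddChar (((∑ i, Y i ω : ℤ) : ZMod p) * t) : ℂ) ∂μ
      = (expSum (A.image (Int.cast : ℤ → ZMod p)) t / A.card) ^ ℓ := by
  set f : ℤ → ℂ := fun z => ZMod.stdAddChar ((z : ZMod p) * t) with hf
  have hprod : ∀ ω, (ZMod.stdAddChar (((∑ i, Y i ω : ℤ) : ZMod p) * t) : ℂ)
      = ∏ i, f (Y i ω) := by
    intro ω
    rw [Int.cast_sum, Finset.sum_mul, hf]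
    induction (Finset.univ : Finset (Fin ℓ)) using Finset.cons_induction with
    | empty => simp
    | cons i s hi ih => rw [Finset.sum_cons, Finset.prod_cons, AddChar.map_add_eq_mul, ih]
  simp_rw [hprod]
  rw [h.1.integral_fun_prod_comp (f := fun _ => f) (fun i => (h.2 i).aemeasurable)
    fun i => (measurable_of_countable f).aestronglyMeasurable]
  have hi : ∀ i, ∫ ω, f (Y i ω) ∂μ = expSum (A.image (Int.cast : ℤ → ZMod p)) t / A.card := by
    intro i
    have := (h.2 i).integral_comp (f := f) (measurable_of_countable f).aestronglyMeasurable
    rw [Function.comp_def] at this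
    rw [this, integral_uniformOn_finset, expSum, Finset.sum_image hA]
  simp only [hi, Finset.prod_const, Finset.card_univ, Fintype.card_fin]

lemma exists_prime_ge_injOn_intCast (A : Finset ℤ) (N : ℕ) :
    ∃ p : ℕ, p.Prime ∧ N ≤ p ∧ Set.InjOn (Int.cast : ℤ → ZMod p) A := by
  obtain ⟨p, hp, hpp⟩ := Nat.exists_infinite_primes (N + 2 * ∑ a ∈ A, a.natAbs + 1)
  refine ⟨p, hpp, by omega, fun a ha b hb hab => ?_⟩
  have h1 := (ZMod.intCast_eq_intCast_iff_dvd_sub a b p).1 hab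
  have ha' := Finset.single_le_sum (fun i _ => Nat.zero_le (Int.natAbs i)) ha
  have hb' := Finset.single_le_sum (fun i _ => Nat.zero_le (Int.natAbs i)) hb
  have := Int.eq_zero_of_abs_lt_dvd h1 (by rw [abs_lt]; omega)
  omega

lemma IsIIDUniformOn.pointProb_le {ℓ : ℕ} {Y : Fin ℓ → Ω → ℤ} {A : Finset ℤ}
    [IsProbabilityMeasure μ] (h : IsIIDUniformOn μ Y A) (hA : 2 ≤ A.card) (hℓ : 2 ≤ ℓ) (x : ℤ) :
    μ.real {ω | ∑ i, Y i ω = x} ≤ 92 / (A.card * √((ℓ : ℝ) - 1)) := by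
  obtain ⟨p, hp, hN, hinj⟩ := exists_prime_ge_injOn_intCast A (A.card * ℓ)
  have : Fact p.Prime := ⟨hp⟩
  have hp0 : (0 : ℝ) < p := by exact_mod_cast hp.pos
  have hcard : (A.image (Int.cast : ℤ → ZMod p)).card = A.card := Finset.card_image_of_injOn hinj
  have hZ : AEMeasurable (fun ω => ∑ i, Y i ω) μ :=
    Finset.aemeasurable_fun_sum _ fun i _ => (h.2 i).aemeasurable
  have h1 := pointProb_le_sum_norm_charFun hZ (p := p) x
  simp_rw [h.integral_stdAddChar_sum hinj, norm_pow, norm_div, Complex.norm_natCast] at h1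
  have h2 := sum_norm_expSum_div_pow_le (A.image (Int.cast : ℤ → ZMod p)) (by omega) hℓ
    (by rwa [hcard])
  rw [hcard] at h2
  refine le_of_mul_le_mul_left ((h1.trans h2).trans_eq ?_) hp0
  rw [mul_div_assoc', mul_div_assoc', div_div, mul_comm (p : ℝ)]

end Probability

theorem mainTheorem6 :
    (∃ D : ℝ, ∀ (n ℓ : ℕ), 2 ≤ n → 2 ≤ ℓ → ∀ A : Finset ℤ, A.card = n →
      ∀ (Ω : Type u) [MeasurableSpace Ω] (μ : Measure Ω) [IsProbabilityMeasure μ]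
        (Y : Fin ℓ → Ω → ℤ), IsIIDUniformOn μ Y A →
        ∃ m : ℝ, IsMaxPointProb μ (fun ω => ∑ i, Y i ω) m ∧
          m ≤ D / ((n : ℝ) * Real.sqrt ((ℓ : ℝ) - 1))) ∧
    (∀ ε : ℝ, 0 < ε → ∃ L : ℕ, ∀ (n ℓ : ℕ), 2 ≤ n → L ≤ ℓ → ∀ A : Finset ℤ, A.card = n →
      ∀ (Ω : Type u) [MeasurableSpace Ω] (μ : Measure Ω) [IsProbabilityMeasure μ]
        (Y : Fin ℓ → Ω → ℤ), IsIIDUniformOn μ Y A →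
        ∃ m : ℝ, IsMaxPointProb μ (fun ω => ∑ i, Y i ω) m ∧ m ≤ ε / (n : ℝ)) := by
  have main : ∀ (n ℓ : ℕ), 2 ≤ n → 2 ≤ ℓ → ∀ A : Finset ℤ, A.card = n →
      ∀ (Ω : Type u) [MeasurableSpace Ω] (μ : Measure Ω) [IsProbabilityMeasure μ]
        (Y : Fin ℓ → Ω → ℤ), IsIIDUniformOn μ Y A →
        ∃ m : ℝ, IsMaxPointProb μ (fun ω => ∑ i, Y i ω) m ∧
          m ≤ 92 / ((n : ℝ) * Real.sqrt ((ℓ : ℝ) - 1)) := by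
    rintro n ℓ hn hℓ A rfl Ω _ μ _ Y hY
    obtain ⟨m, hm⟩ := exists_isMaxPointProb (μ := μ) (Z := fun ω => ∑ i, Y i ω)
      (Finset.aemeasurable_fun_sum _ fun i _ => (hY.2 i).aemeasurable)
    refine ⟨m, hm, ?_⟩
    obtain ⟨x, rfl⟩ := hm.1
    exact hY.pointProb_le hn hℓ x
  refine ⟨⟨92, main⟩, fun ε hε => ?_⟩
  obtain ⟨N, hN⟩ := exists_nat_gt ((92 / ε) ^ 2)
  refine ⟨N + 2, fun n ℓ hn hℓ A hA Ω _ μ _ Y hY => ?_⟩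
  obtain ⟨m, hm, hle⟩ := main n ℓ hn (by omega) A hA Ω μ Y hY
  refine ⟨m, hm, hle.trans ?_⟩
  have hn' : (0 : ℝ) < n := by exact_mod_cast (by omega : 0 < n)
  have hℓ' : (N : ℝ) + 2 ≤ ℓ := by exact_mod_cast hℓ
  have hs : 92 / ε ≤ √((ℓ : ℝ) - 1) := Real.le_sqrt_of_sq_le (by linarith)
  have hs0 : 0 < √((ℓ : ℝ) - 1) := lt_of_lt_of_le (by positivity) hs
  rw [mul_comm, ← div_div]
  gcongr
  rw [div_le_iff₀ hs0]
  rw [div_le_iff₀ hε] at hs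
  linarith
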